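/- Let $K$ be a field of characteristic $0$. **Triangular separable algebras.** A triangular separable $K$-algebra $R=K[a_1,\dots,a_n],\,p_1,\dots,p_n$ is a $K$-algebra together with a presentation obtained from $K$ by finitely many (possibly zero) extensions $R_l=R_{l-1}[a_l]=R_{l-1}[X]/\langle p_l\rangle$, $R_0=K$, $R=R_n$, where $p_l\in R_{l-1}[X]$ is monic, nonconstant and separable ($rp_l+sp_l'=1$ for some $r,s\in R_{l-1}[X]$). If $p_l=gq$ with $g,q$ monic and nonconstant, then $R$ decomposes as the product of the two triangular separable algebras in which $p_l$ is replaced by $g$, respectively by $q$ (the later $p_j$ being replaced by their images); iterating, one obtains the decompositions of $R$. Their components are exactly the refinements of $R$, i.e. the algebras $R'=K[b_1,\dots,b_n],\,q_1,\dots,q_n$ with each $q_l$ a monic, nonconstant divisor of $p_l(b_1,\dots,b_{l-1},X)$. **Splitting.** With $m_l=\deg p_l$, a $K$-algebra $A$ *splits* $R$ if there are elements $a_{i_1,\dots,i_l}\in A$ ($1\le l\le n$, $1\le i_j\le m_j$) such that $p_1=\prod_{d=1}^{m_1}(X-a_d)$ and $p_{l+1}(a_{i_1},a_{i_1,i_2},\dots,a_{i_1,\dots,i_l},X)=\prod_{d=1}^{m_{l+1}}(X-a_{i_1,\dots,i_l,d})$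 in $A[X]$ for $1\le l<n$ and all $i_1,\dots,i_l$. **The algorithm.** The input is a monic nonconstant $F\in K[[X]][Y]$ that is separable over $K((X))$. A state consists of a triangular separable algebra $R$, an integer $M>0$ and a list $H_1,\dots,H_r$ of monic polynomials in $R[[T]][Y]$ with $F(T^M,Y)=H_1\cdots H_r$. The initial state is $R=K$, $M=1$, $H_1=F$. The algorithm stops, with $R$ the algebra obtained, if all $H_i$ have degree $1$ in $Y$. Otherwise let $H=H_i$ be the first one of degree $N>1$. Choose a component $R'$ of a decomposition of $R$ and carry out the following over $R'$ (the choices being such that the stated conditions hold). 1. Write $H(T,W-\alpha_1/N)=W^N+\sum_{i=2}^N\beta_i(T)W^{N-i}$, where $\alpha_1$ is the coefficient of $Y^{N-1}$ in $H$, and put $\beta_1=0$. Find $1<m\le N$ and $p\ge 0$ such that the coefficient $\beta_m(p)$ of $T^p$ in $\beta_m$ is a unit of $R'$, and $\beta_i(j)=0$ whenever $1\le i\le N$ and $j/i<p/m$. 2. Choose integers $e>0$, $d\ge 0$ with $d/e=p/m$ (such as $e=m$, $d=p$; or $e=1$, $d=0$ if $p=0$), and let $F_1\in R'[[T]][Z]$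 be given by $T^{Nd}F_1(T,Z)=(T^dZ)^N+\sum_{i=2}^N\beta_i(T^e)(T^dZ)^{N-i}$. 3. Choose a monic nonconstant separable $q\in R'[X]$ such that over $S=R'[a]=R'[X]/\langle q\rangle$ one has $F_1(0,Z)=(Z-a)^sL(Z)$ for some $s>0$ and some $L\in S[Z]$ with $L(a)$ a unit. By Hensel's lemma, lift this to $F_1=G_1H_1$ with $G_1,H_1\in S[[T]][Z]$ monic, $G_1(0,Z)=(Z-a)^s$, $H_1(0,Z)=L$. 4. With $W=Y+\alpha_1(T^e)/N$, $t=\deg G_1$, $u=\deg H_1$, put $G=T^{td}G_1(T,W/T^d)$ and $G'=T^{ud}H_1(T,W/T^d)$, so that $H(T^e,Y)=G\,G'$. The new state is $S$, $Me$, and $H_1(T^e,Y),\dots,H_{i-1}(T^e,Y),G,G',H_{i+1}(T^e,Y),\dots,H_r(T^e,Y)$. Since the choices of components and of extensions are free, different runs on the same $F$ may end in different algebras. **Corollary.** Let $F\in K[[X]][Y]$ be monic, nonconstant and separable over $K((X))$, and let $A$ and $B$ be two triangular separable algebras obtained by runs of this algorithm on $F$. Then $A$ splits $B$ and $B$ splits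 $A$. Consequently, every triangular separable algebra obtained by the algorithm splits itself. -/

import Mathlib

universe u v

open scoped Polynomial PowerSeries

noncomputable section

namespace DynamicPuiseux

/-- A triangular separable `K`-algebra `R = K[a₁, …, aₙ]`, `p₁(a₁) = 0`, `p₂(a₁, a₂) = 0`, …,
together with its presentation: `K` itself is the case `n = 0`, and one passes from
`R = K[a₁, …, aₗ]` to `R[aₗ₊₁] = R[X]/⟨p⟩` for a monic, separable, nonconstant `p ∈ R[X]`.
(`Polynomial.Separable p` says `r p + s p' = 1` for some `r`, `s`, over any commutative ring.) -/
inductive Tower (K : Type u) [Field K] : (R : Type u) → [CommRing R] → [Algebra K R] → Type (u + 1)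
  | base : Tower K K
  | adjoin {R : Type u} [CommRing R] [Algebra K R] (t : Tower K R) (p : R[X]) (monic : p.Monic)
      (separable : p.Separable) (nonconst : 0 < p.natDegree) : Tower K (AdjoinRoot p)

/-- The multi-indices `(i₁, …, iₙ)`, `0 ≤ iⱼ < mⱼ = deg pⱼ`. -/
def Tower.Idx {K : Type u} [Field K] :
    {R : Type u} → [CommRing R] → [Algebra K R] → Tower K R → Type
  | _, _, _, Tower.base => Unit
  | _, _, _, @Tower.adjoin _ _ _ _ _ t p _ _ _ => t.Idx × Fin p.natDegree

/-- `ψ` is the collection of the homomorphisms `R → A`, `aₗ ↦ a_{i₁,…,iₗ}`, that a splitting family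
`(a_{i₁,…,iₗ})` of elements of `A` defines.  At the last level, with `φ` the homomorphisms
`K[a₁, …, aₗ] → A` of the lower levels, there are elements `a_{i₁,…,iₗ,d}` of `A` such that
`pₗ₊₁(a_{i₁}, …, a_{i₁,…,iₗ}, X) = ∏_d (X - a_{i₁,…,iₗ,d})`, and `ψ (i, d)` extends `φ i` by sending
`aₗ₊₁` to `a_{i₁,…,iₗ,d}`. -/
def Tower.IsSplitting {K : Type u} [Field K] (A : Type v) [CommRing A] [Algebra K A] :
    {R : Type u} → [CommRing R] → [Algebra K R] → (t : Tower K R) → (t.Idx → (R →ₐ[K] A)) → Prop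
  | _, _, _, Tower.base, _ => True
  | _, _, _, @Tower.adjoin _ _ R _ _ t p _ _ _, ψ =>
      ∃ (φ : t.Idx → (R →ₐ[K] A)) (a : t.Idx → Fin p.natDegree → A),
        t.IsSplitting A φ ∧
        (∀ i, p.map (φ i : R →+* A) = ∏ d, (Polynomial.X - Polynomial.C (a i d))) ∧
        (∀ i d, (ψ (i, d)).comp (AdjoinRoot.ofAlgHom K p) = φ i ∧
          ψ (i, d) (AdjoinRoot.root p) = a i d)

/-- The `K`-algebra `A` splits the triangular separable algebra `R` (with presentation `t`). -/
def Splits {K : Type u} [Field K] (A : Type v) [CommRing A] [Algebra K A]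
    {R : Type u} [CommRing R] [Algebra K R] (t : Tower K R) : Prop :=
  ∃ ψ : t.Idx → (R →ₐ[K] A), t.IsSplitting A ψ

/-- `Refines t t' ρ`: the triangular separable algebra `R' = K[b₁, …, bₙ], q₁, …, qₙ` is a
refinement of `R = K[a₁, …, aₙ], p₁, …, pₙ`, i.e. `qₗ ∣ pₗ(b₁, …, bₗ₋₁, X)` for all `l`, and
`ρ : R → R'` is the quotient map `aₗ ↦ bₗ`.  These are exactly the algebras occurring in the
decompositions of `R`, which arise by repeatedly replacing a `pₗ = g q` by `g` or by `q`. -/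
inductive Refines {K : Type u} [Field K] :
    {R : Type u} → [CommRing R] → [Algebra K R] → Tower K R →
    {R' : Type u} → [CommRing R'] → [Algebra K R'] → Tower K R' → (R →ₐ[K] R') → Prop
  | base : Refines Tower.base Tower.base (AlgHom.id K K)
  | adjoin {R : Type u} [CommRing R] [Algebra K R] {t : Tower K R}
      {R' : Type u} [CommRing R'] [Algebra K R'] {t' : Tower K R'} {ρ : R →ₐ[K] R'}
      (h : Refines t t' ρ)
      (p : R[X]) (hpm : p.Monic) (hps : p.Separable) (hpd : 0 < p.natDegree)
      (q : R'[X]) (hqm : q.Monic) (hqs : q.Separable) (hqd : 0 < q.natDegree)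
      (hdvd : q ∣ p.map (ρ : R →+* R')) :
      Refines (t.adjoin p hpm hps hpd) (t'.adjoin q hqm hqs hqd)
        (AdjoinRoot.mapAlgHom ρ p q hdvd)

/-- Base change `R[[T]][Y] → S[[T]][Y]` along `f : R → S`. -/
def baseChange {R S : Type*} [CommRing R] [CommRing S] (f : R →+* S) (H : R⟦X⟧[X]) : S⟦X⟧[X] :=
  H.map (PowerSeries.map f)

/-- The substitution `H(T, Y) ↦ H(Tᵉ, Y)`, `e > 0`. -/
def ramify {R : Type*} [CommRing R] (e : ℕ) (he : e ≠ 0) (H : R⟦X⟧[X]) : R⟦X⟧[X] :=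
  H.map (PowerSeries.expand e he : R⟦X⟧ →ₐ[R] R⟦X⟧).toRingHom

/-- The specialization `H(0, Y)`. -/
def atZero {R : Type*} [CommRing R] (H : R⟦X⟧[X]) : R[X] :=
  H.map (PowerSeries.constantCoeff (R := R))

/-- `α₁ / n` for `H = Yⁿ + α₁ Yⁿ⁻¹ + … + αₙ`. -/
def center (K : Type u) [Field K] {R : Type u} [CommRing R] [Algebra K R] (H : R⟦X⟧[X]) : R⟦X⟧ :=
  (H.natDegree : K)⁻¹ • H.coeff (H.natDegree - 1)

/-- One factorization step over a chosen component `R'` of a decomposition and a chosen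
separable extension `S = R'[a]`, `a` a root of `q`.  The polynomial `H ∈ R'[[T]][Y]` is monic
of degree `n ≥ 2`; the result is a factorization `H(Tᵉ, Y) = G(T, Y) G'(T, Y)` over `S[[T]]`. -/
inductive KeyStep (K : Type u) [Field K] {R' : Type u} [CommRing R'] [Algebra K R']
    (q : R'[X]) (H : R'⟦X⟧[X]) (e : ℕ) (he : e ≠ 0) (G G' : (AdjoinRoot q)⟦X⟧[X]) : Prop
  | mk (n : ℕ) (hn : n = H.natDegree)
      -- `H₀(T, W) = H(T, W - α₁/n) = Wⁿ + α₂ Wⁿ⁻² + … + αₙ`, where `αᵢ = H₀.coeff (n - i)`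
      (H₀ : R'⟦X⟧[X])
      (hH₀ : H₀ = H.comp (Polynomial.X - Polynomial.C (center K H)))
      -- the slope `p / m`: `αₘ(p)` is invertible and `αᵢ(j) = 0` whenever `j / i < p / m`
      (m p : ℕ) (hm : 1 < m) (hmn : m ≤ n)
      (hunit : IsUnit (PowerSeries.coeff p (H₀.coeff (n - m))))
      (hzero : ∀ i j : ℕ, 0 < i → i ≤ n → j * m < p * i →
        PowerSeries.coeff j (H₀.coeff (n - i)) = 0)
      -- `d / e = p / m`, e.g. `e = m` and `d = p`, or `e = 1` and `d = 0` if `p = 0`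
      (d : ℕ) (hd : d * m = p * e)
      -- `H₀(Tᵉ, Tᵈ Z) = Tⁿᵈ F₁(T, Z)`
      (F₁ : R'⟦X⟧[X])
      (hF₁ : (ramify e he H₀).comp (Polynomial.C (PowerSeries.X ^ d) * Polynomial.X) =
        Polynomial.C (PowerSeries.X ^ (n * d)) * F₁)
      -- `F₁(0, Z) = (Z - a)ˢ L(Z)` over `S`, with `L(a)` invertible
      (s : ℕ) (hs : 0 < s) (L : (AdjoinRoot q)[X])
      (hL : (atZero F₁).map (AdjoinRoot.of q) =
        (Polynomial.X - Polynomial.C (AdjoinRoot.root q)) ^ s * L)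
      (hLunit : IsUnit (L.eval (AdjoinRoot.root q)))
      -- the Hensel lift `F₁ = G₁ H₁` of this factorization
      (G₁ H₁ : (AdjoinRoot q)⟦X⟧[X]) (hG₁ : G₁.Monic) (hH₁ : H₁.Monic)
      (hfac : baseChange (AdjoinRoot.of q) F₁ = G₁ * H₁)
      (hG₁0 : atZero G₁ = (Polynomial.X - Polynomial.C (AdjoinRoot.root q)) ^ s)
      (hH₁0 : atZero H₁ = L)
      -- back to `H`: `T^{td} G₁(T, W/Tᵈ)` and `T^{ud} H₁(T, W/Tᵈ)`, with `t = deg G₁`,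
      -- `u = deg H₁` and `W = Y + α₁(Tᵉ)/n`
      (c : (AdjoinRoot q)⟦X⟧)
      (hc : c = PowerSeries.map (AdjoinRoot.of q) (PowerSeries.expand e he (center K H)))
      (hG : G = (G₁.scaleRoots (PowerSeries.X ^ d)).comp (Polynomial.X + Polynomial.C c))
      (hG' : G' = (H₁.scaleRoots (PowerSeries.X ^ d)).comp (Polynomial.X + Polynomial.C c)) :
      KeyStep K q H e he G G'

/-- `Reaches F t m l`: some run of the algorithm on `F ∈ K[[X]][Y]` arrives at the triangular
separable algebra `R` (with presentation `t`), the number `m` and the list `l = [H₁, …, Hᵣ]` of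
polynomials in `R[[T]][Y]` with `F(Tᵐ, Y) = H₁ ⋯ Hᵣ`.  In a step, the first `Hᵢ` of degree `> 1`
is factored over a separable extension of a selected component of a decomposition of `R`. -/
inductive Reaches {K : Type u} [Field K] (F : K⟦X⟧[X]) :
    {R : Type u} → [CommRing R] → [Algebra K R] → Tower K R → ℕ → List (R⟦X⟧[X]) → Prop
  | start : Reaches F Tower.base 1 [F]
  | step {R : Type u} [CommRing R] [Algebra K R] {t : Tower K R} {m : ℕ}
      {pre : List (R⟦X⟧[X])} {H : R⟦X⟧[X]} {post : List (R⟦X⟧[X])}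
      (h : Reaches F t m (pre ++ H :: post))
      (hpre : ∀ P ∈ pre, P.natDegree = 1) (hH : 1 < H.natDegree)
      -- the selected component `R'` of a decomposition of `R`
      {R' : Type u} [CommRing R'] [Algebra K R'] {t' : Tower K R'} {ρ : R →ₐ[K] R'}
      (href : Refines t t' ρ)
      -- the separable extension `S = R'[a]`
      (q : R'[X]) (hqm : q.Monic) (hqs : q.Separable) (hqd : 0 < q.natDegree)
      (e : ℕ) (he : e ≠ 0) (G G' : (AdjoinRoot q)⟦X⟧[X])
      (hkey : KeyStep K q (baseChange (ρ : R →+* R') H) e he G G') :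
      Reaches F (t'.adjoin q hqm hqs hqd) (m * e)
        (pre.map (fun P => ramify e he (baseChange ((AdjoinRoot.of q).comp (ρ : R →+* R')) P)) ++
          G :: G' ::
          post.map (fun P => ramify e he (baseChange ((AdjoinRoot.of q).comp (ρ : R →+* R')) P)))

/-- The triangular separable algebra `R` (with presentation `t`) is obtained by the algorithm
applied to `F`: a run arrives at `R` with all factors of degree `1`, where it stops. -/
def Produced {K : Type u} [Field K] (F : K⟦X⟧[X])
    {R : Type u} [CommRing R] [Algebra K R] (t : Tower K R) : Prop :=
  ∃ (m : ℕ) (l : List (R⟦X⟧[X])), Reaches F t m l ∧ ∀ P ∈ l, P.natDegree = 1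

end DynamicPuiseux

end

/-! A triangular separable algebra `A` is finite and unramified over `K`, hence reduced and
Artinian, hence a product of residue fields `k`. Splitting families can be assembled componentwise,
so it suffices that each `k` splits `B`. For this it is enough that every homomorphism from `B` to
an algebraic closure `L` of `k` has values in `k`.

The run ending in `A` makes `F(T^m₀, Y)` a product of linear factors over `k⟦T⟧`. Follow the run
ending in `B`, mapped into `L`: every factor `G` it creates divides some `F(T^M, Y)`, so after `T ↦
T^m₀` its roots are power series over `k`. Such a root `y` satisfies `y + c(T^m₀) = T^(m₀ d) z` with
`z` a root of the Hensel factor, whose constant term is the adjoined element `a`. Thus `a` is a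
coefficient of a series over `k` (`KeyStep.root_mem_range`), and induction along the run
(`Reaches.range_le`) puts the whole image in `k`. -/

namespace DynamicPuiseux

/-! ### Unramifiedness of triangular separable algebras; surjectivity of refinements -/

section Algebras

open KaehlerDifferential in
/-- Adjoining a root of a separable polynomial is a formally unramified extension. -/
theorem formallyUnramified_adjoinRoot {R : Type u} [CommRing R] {p : R[X]} (hp : p.Separable) :
    Algebra.FormallyUnramified R (AdjoinRoot p) := by
  constructor
  -- Differentiating `p(a) = 0` gives `p'(a) da = 0`, and `p'(a)` is a unit by separability.
  have hroot : D R (AdjoinRoot p) (AdjoinRoot.root p) = 0 := by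
    have h1 := (D R (AdjoinRoot p)).map_aeval p (AdjoinRoot.root p)
    rw [AdjoinRoot.aeval_eq, AdjoinRoot.mk_self, map_zero] at h1
    obtain ⟨r, s, hrs⟩ := hp
    have h2 := congrArg (Polynomial.aeval (AdjoinRoot.root p)) hrs
    simp only [map_add, map_mul, map_one, AdjoinRoot.aeval_eq p, AdjoinRoot.mk_self, mul_zero,
      zero_add] at h2
    rw [← one_smul (AdjoinRoot p) (D R (AdjoinRoot p) (AdjoinRoot.root p)), ← h2, mul_smul,
      ← h1, smul_zero]
  have hD : ∀ x, D R (AdjoinRoot p) x = 0 := fun x => by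
    obtain ⟨f, rfl⟩ := AdjoinRoot.mk_surjective x
    rw [← AdjoinRoot.aeval_eq, Derivation.map_aeval, hroot, smul_zero]
  have htop := span_range_derivation R (AdjoinRoot p)
  rw [Submodule.span_eq_bot.mpr (by rintro _ ⟨x, rfl⟩; exact hD x)] at htop
  exact (Submodule.subsingleton_iff (AdjoinRoot p)).mp (subsingleton_of_bot_eq_top htop)

theorem Tower.finite_formallyUnramified {K : Type u} [Field K] {R : Type u} [CommRing R]
    [Algebra K R] (t : Tower K R) : Module.Finite K R ∧ Algebra.FormallyUnramified K R := by
  induction t with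
  | base => exact ⟨inferInstance, inferInstance⟩
  | @adjoin R _ _ t p hm hs hd ih =>
    obtain ⟨_, _⟩ := ih
    have := hm.finite_adjoinRoot
    have := formallyUnramified_adjoinRoot hs
    exact ⟨Module.Finite.trans R _, Algebra.FormallyUnramified.comp K R _⟩

/-- Lets a statement about the image of `R'` be deduced from the one about the image of `R`. -/
theorem Refines.surjective {K : Type u} [Field K] {R : Type u} [CommRing R] [Algebra K R]
    {t : Tower K R} {R' : Type u} [CommRing R'] [Algebra K R'] {t' : Tower K R'} {ρ : R →ₐ[K] R'}
    (h : Refines t t' ρ) : Function.Surjective ρ := by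
  induction h with
  | base => exact Function.surjective_id
  | @adjoin R _ _ t R' _ _ t' ρ h p _ _ _ q _ _ _ hdvd ih =>
    intro x
    induction x using AdjoinRoot.induction_on with
    | ih f =>
      obtain ⟨g, rfl⟩ := Polynomial.map_surjective (ρ : R →+* R') ih f
      refine ⟨AdjoinRoot.mk p g, ?_⟩
      rw [AdjoinRoot.coe_mapAlgHom, AdjoinRoot.map, AdjoinRoot.lift_mk, ← Polynomial.eval₂_map,
        ← AdjoinRoot.algebraMap_eq, ← Polynomial.aeval_def, AdjoinRoot.aeval_eq]

end Algebras

/-! ### Splitting over products and over fields -/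

section Splitting

variable {K : Type u} [Field K]

/-- Splitting families with values in the factors of a product assemble to one with values in
the product. -/
theorem Tower.IsSplitting.pi {ι : Type*} {k : ι → Type v} [∀ i, CommRing (k i)]
    [∀ i, Algebra K (k i)] {A : Type v} [CommRing A] [Algebra K A] (e : A ≃ₐ[K] ∀ i, k i)
    {R : Type u} [CommRing R] [Algebra K R] (t : Tower K R) (ψ : ∀ i, t.Idx → (R →ₐ[K] k i))
    (h : ∀ i, t.IsSplitting (k i) (ψ i)) :
    t.IsSplitting A (fun j => (e.symm : (∀ i, k i) →ₐ[K] A).comp (AlgHom.pi fun i => ψ i j)) := by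
  induction t with
  | base => trivial
  | @adjoin R _ _ t p hm hs hd ih =>
    choose φ a hφ hp hψ using h
    refine ⟨_, fun j d => e.symm fun i => a i j d, ih φ hφ, fun j => ?_, fun j d => ⟨?_, ?_⟩⟩
    · apply Polynomial.map_injective (e : A →+* ∀ i, k i) e.injective
      ext n i
      have := congrArg (Polynomial.coeff · n) (hp i j)
      simp only [Polynomial.coeff_map] at this
      have h2 : ∀ Q : A[X], (Q.map (e : A →+* ∀ i, k i)).coeff n i =
          (Q.map ((Pi.evalRingHom k i).comp (e : A →+* ∀ i, k i))).coeff n := by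
        intro Q; simp
      rw [h2 (∏ d, _), Polynomial.map_prod]
      simpa using this
    · ext x
      apply e.injective
      ext i
      simpa using DFunLike.congr_fun (hψ i j d).1 x
    · apply e.injective
      ext i
      simpa using (hψ i j d).2

theorem splits_of_algEquiv_pi {ι : Type*} {k : ι → Type v} [∀ i, CommRing (k i)]
    [∀ i, Algebra K (k i)] {A : Type v} [CommRing A] [Algebra K A] (e : A ≃ₐ[K] ∀ i, k i)
    {R : Type u} [CommRing R] [Algebra K R] (t : Tower K R) (h : ∀ i, Splits (k i) t) :
    Splits A t := by
  choose ψ hψ using h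
  exact ⟨_, Tower.IsSplitting.pi e t ψ hψ⟩

theorem exists_eq_prod_of_splits {k : Type v} [Field k] {f : k[X]} (hf : f.Splits) (hm : f.Monic)
    {n : ℕ} (hn : f.natDegree = n) :
    ∃ a : Fin n → k, f = ∏ d, (Polynomial.X - Polynomial.C (a d)) := by
  have hlen : f.roots.toList.length = n := by
    rw [Multiset.length_toList, ← hf.natDegree_eq_card_roots, hn]
  refine ⟨fun d => f.roots.toList.get (d.cast hlen.symm), ?_⟩
  subst hlen
  conv_lhs => rw [hf.eq_prod_roots_of_monic hm, ← Multiset.coe_toList f.roots]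
  rw [Multiset.map_coe, Multiset.prod_coe, ← Fin.prod_ofFn]
  congr 1
  apply List.ext_get <;> simp

variable {k : Type v} [Field k] [Algebra K k] {L : Type v} [Field L] [IsAlgClosed L]
  [Algebra K L]

/-- A field `k` splits `R` if all homomorphisms from `R` to an algebraically closed extension `L`
of `k` have values in `k`. -/
theorem splits_of_forall_range_le (f : k →ₐ[K] L) {R : Type u} [CommRing R] [Algebra K R]
    (t : Tower K R) (h : ∀ φ : R →ₐ[K] L, φ.range ≤ f.range) : Splits k t := by
  induction t with
  | base => exact ⟨fun _ => Algebra.ofId K k, trivial⟩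
  | @adjoin R _ _ t p hm hs hd ih =>
    -- A pair of `φ` and a root of the image of `p` is a homomorphism on `R[X]/⟨p⟩`, to which `h`
    -- applies.
    have ext_root : ∀ (φ : R →ₐ[K] L) (x : L), p.eval₂ (φ : R →+* L) x = 0 → x ∈ f.range ∧
        φ.range ≤ f.range := by
      intro φ x hx
      have hr := h (AdjoinRoot.liftAlgHom p φ x hx)
      refine ⟨hr ⟨AdjoinRoot.root p, AdjoinRoot.liftAlgHom_root ..⟩, ?_⟩
      rintro _ ⟨y, rfl⟩
      exact hr ⟨AdjoinRoot.of p y, AdjoinRoot.liftAlgHom_of ..⟩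
    -- Every `φ` extends to `R[X]/⟨p⟩`, because the nonconstant `p` has a root in `L`.
    have hRange : ∀ φ : R →ₐ[K] L, φ.range ≤ f.range := by
      intro φ
      obtain ⟨x, hx⟩ := IsAlgClosed.exists_root (p.map (φ : R →+* L)) (by
        rw [hm.degree_map]
        exact (Polynomial.natDegree_pos_iff_degree_pos.mp hd).ne')
      rw [Polynomial.IsRoot, Polynomial.eval_map] at hx
      exact (ext_root φ x hx).2
    obtain ⟨φ, hφ⟩ := ih hRange
    -- The image of `p` splits over `L` with all roots coming from `k`, so it already splits over
    -- `k`.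
    have hsplits : ∀ i, (p.map (φ i : R →+* k)).Splits := by
      intro i
      refine Polynomial.Splits.of_splits_map (f : k →+* L) (IsAlgClosed.splits _) fun x hx => ?_
      rw [Polynomial.map_map] at hx
      have hx' := Polynomial.isRoot_of_mem_roots hx
      rw [Polynomial.IsRoot, Polynomial.eval_map] at hx'
      exact (ext_root (f.comp (φ i)) x hx').1
    choose a ha using fun i => exists_eq_prod_of_splits (hsplits i) (hm.map _)
      (hm.natDegree_map (φ i : R →+* k))
    have hroot : ∀ i d, p.eval₂ (φ i : R →+* k) (a i d) = 0 := by
      intro i d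
      rw [← Polynomial.eval_map, ha, Polynomial.eval_prod]
      exact Finset.prod_eq_zero (Finset.mem_univ d) (by simp)
    refine ⟨fun j => AdjoinRoot.liftAlgHom p (φ j.1) (a j.1 j.2) (hroot j.1 j.2), φ, a, hφ, ha,
      fun i d => ⟨?_, AdjoinRoot.liftAlgHom_root ..⟩⟩
    ext x
    exact AdjoinRoot.liftAlgHom_of (p := p) (φ i) (a i d) (hroot i d) x

end Splitting

/-! ### Base change, ramification and scaling of roots -/

section Substitution

variable {R S : Type*} [CommRing R] [CommRing S]

theorem baseChange_ramify (f : R →+* S) (e : ℕ) (he : e ≠ 0) (H : R⟦X⟧[X]) :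
    baseChange f (ramify e he H) = ramify e he (baseChange f H) := by
  rw [baseChange, ramify, baseChange, ramify, Polynomial.map_map, Polynomial.map_map]
  congr 1
  ext1 x
  exact PowerSeries.map_expand e he f x

theorem baseChange_baseChange {U : Type*} [CommRing U] (f : R →+* S) (g : S →+* U)
    (H : R⟦X⟧[X]) : baseChange g (baseChange f H) = baseChange (g.comp f) H := by
  rw [baseChange, baseChange, baseChange, Polynomial.map_map, PowerSeries.map_comp]

theorem ramify_ramify (e m : ℕ) (he : e ≠ 0) (hm : m ≠ 0) (H : R⟦X⟧[X]) :
    ramify e he (ramify m hm H) = ramify (m * e) (mul_ne_zero hm he) H := by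
  rw [ramify, ramify, ramify, Polynomial.map_map]
  congr 1
  ext1 x
  simp only [mul_comm m e]
  exact (PowerSeries.expand_mul e he m hm x).symm

/-- `P(D Z) = Dⁿ Q(Z)` determines `P` as the polynomial whose roots are those of `Q` scaled
by `D`. -/
theorem eq_scaleRoots_of_comp_eq {D : R} (hD : IsRegular D) {P Q : R[X]} (hP : P.Monic)
    (h : P.comp (Polynomial.C D * Polynomial.X) = Polynomial.C (D ^ P.natDegree) * Q) :
    P = Q.scaleRoots D := by
  nontriviality R
  have hcoeff : ∀ i, P.coeff i * D ^ i = D ^ P.natDegree * Q.coeff i := fun i => by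
    simpa only [Polynomial.comp_C_mul_X_coeff, Polynomial.coeff_C_mul] using congrArg (Polynomial.coeff · i) h
  have hcancel : ∀ (j : ℕ) {x y : R}, D ^ j * x = D ^ j * y → x = y := fun j _ _ hxy =>
    (hD.pow j).left hxy
  -- The degree of `Q` is not given; comparing coefficients and cancelling powers of `D` forces `Q`
  -- to be monic of the degree of `P`.
  have hlead : Q.coeff P.natDegree = 1 := by
    apply hcancel P.natDegree
    rw [← hcoeff, hP.coeff_natDegree, one_mul, mul_one]
  have hdeg : Q.natDegree = P.natDegree := by
    refine le_antisymm ?_ (Polynomial.le_natDegree_of_ne_zero (by rw [hlead]; exact one_ne_zero))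
    rw [Polynomial.natDegree_le_iff_coeff_eq_zero]
    intro i hi
    apply hcancel P.natDegree
    rw [← hcoeff, Polynomial.coeff_eq_zero_of_natDegree_lt hi, zero_mul, mul_zero]
  ext i
  rw [Polynomial.coeff_scaleRoots, hdeg]
  rcases le_or_gt i P.natDegree with hi | hi
  · apply hcancel i
    rw [mul_comm, hcoeff, mul_left_comm, ← pow_add, Nat.add_sub_cancel' hi, mul_comm]
  · have hi' : Q.natDegree < i := hdeg ▸ hi
    rw [Polynomial.coeff_eq_zero_of_natDegree_lt hi, Polynomial.coeff_eq_zero_of_natDegree_lt hi',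
      zero_mul]

/-- In the fraction field `x / D` is a root of the monic `Q`, so it is integral and lies in `R`. -/
theorem dvd_of_scaleRoots_eval_eq_zero [IsDomain R] [IsIntegrallyClosed R] {Q : R[X]}
    (hQ : Q.Monic) {D x : R} (hD : D ≠ 0) (h : (Q.scaleRoots D).eval x = 0) :
    ∃ z, x = D * z ∧ Q.eval z = 0 := by
  let F := FractionRing R
  have hD' : algebraMap R F D ≠ 0 := by simpa using hD
  have hx : algebraMap R F x = algebraMap R F D * (algebraMap R F x / algebraMap R F D) := by
    rw [mul_div_assoc', mul_div_cancel_left₀ _ hD']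
  have h0 : Q.eval₂ (algebraMap R F) (algebraMap R F x / algebraMap R F D) = 0 := by
    have h1 := Polynomial.scaleRoots_eval₂_mul (p := Q) (algebraMap R F)
      (algebraMap R F x / algebraMap R F D) D
    rw [← hx, Polynomial.eval₂_hom, h, map_zero] at h1
    exact (mul_eq_zero.mp h1.symm).resolve_left (pow_ne_zero _ hD')
  obtain ⟨z, hz⟩ := IsIntegrallyClosed.isIntegral_iff.mp ⟨Q, hQ, h0⟩
  have hxz : x = D * z := by
    apply IsFractionRing.injective R F
    rw [map_mul, hz, ← hx]
  refine ⟨z, hxz, ?_⟩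
  rw [hxz, Polynomial.scaleRoots_eval_mul] at h
  exact (mul_eq_zero.mp h).resolve_left (pow_ne_zero _ hD)

end Substitution

/-! ### Factorizations along a run -/

section Run

variable {K : Type u} [Field K]

/-- Scaling of roots is multiplicative on monic polynomials and undoes `Z = W / Tᵈ`; the translation
by `c` then undoes the centering. -/
theorem KeyStep.mul_eq {R' : Type u} [CommRing R'] [Algebra K R'] {q : R'[X]} {H : R'⟦X⟧[X]}
    {e : ℕ} {he : e ≠ 0} {G G' : (AdjoinRoot q)⟦X⟧[X]} (h : KeyStep K q H e he G G')
    (hH : H.Monic) :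
    G.Monic ∧ G'.Monic ∧ G * G' = ramify e he (baseChange (AdjoinRoot.of q) H) := by
  obtain ⟨n, rfl, _, rfl, m, p, -, -, -, -, d, -, F₁, hF₁, s, -, L, -, -, G₁, H₁, hG₁, hH₁, hfac,
    -, -, c, hc, rfl, rfl⟩ := h
  nontriviality (AdjoinRoot q)⟦X⟧
  have := (PowerSeries.map (AdjoinRoot.of q)).domain_nontrivial
  refine ⟨((Polynomial.monic_scaleRoots_iff _).mpr hG₁).comp_X_add_C c,
    ((Polynomial.monic_scaleRoots_iff _).mpr hH₁).comp_X_add_C c, ?_⟩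
  rw [← baseChange_ramify]
  set H' := baseChange (AdjoinRoot.of q) (ramify e he H) with hH'
  have hmon : H'.Monic := (hH.map _).map _
  have hdeg : H'.natDegree = H.natDegree := by
    rw [hH', baseChange, ramify, (hH.map _).natDegree_map, hH.natDegree_map]
  have hP : baseChange (AdjoinRoot.of q) (ramify e he (H.comp (Polynomial.X -
      Polynomial.C (center K H)))) = H'.comp (Polynomial.X + Polynomial.C (-c)) := by
    rw [hH', hc]
    simp only [baseChange, ramify, Polynomial.map_comp, Polynomial.map_sub, Polynomial.map_X,
      Polynomial.map_C, Polynomial.C_neg, ← sub_eq_add_neg]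
    rfl
  have hPm : (H'.comp (Polynomial.X + Polynomial.C (-c))).Monic := hmon.comp_X_add_C _
  have hPd : (H'.comp (Polynomial.X + Polynomial.C (-c))).natDegree = H.natDegree := by
    rw [← hdeg, ← Polynomial.taylor_apply, Polynomial.natDegree_taylor]
  have hreg : IsRegular (PowerSeries.X ^ d : (AdjoinRoot q)⟦X⟧) := by
    have hl : IsLeftRegular (PowerSeries.X ^ d : (AdjoinRoot q)⟦X⟧) :=
      fun x y hxy => PowerSeries.X_pow_mul_cancel hxy
    exact ⟨hl, hl.right_of_commute (Commute.all _)⟩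
  have hs := eq_scaleRoots_of_comp_eq (D := (PowerSeries.X ^ d : (AdjoinRoot q)⟦X⟧))
    (Q := G₁ * H₁) hreg hPm (by
      have h1 := congrArg (baseChange (AdjoinRoot.of q)) hF₁
      rw [baseChange, Polynomial.map_comp, ← baseChange, hP] at h1
      rw [hPd, ← hfac, ← pow_mul, mul_comm d]
      simpa [baseChange] using h1)
  rw [Polynomial.mul_scaleRoots' _ _ _ (by rw [hG₁.leadingCoeff, hH₁.leadingCoeff]; simp)] at hs
  rw [← Polynomial.mul_comp, ← hs, Polynomial.comp_assoc]
  simp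

/-- The factors of a state are monic, with product `F(Tᵐ, Y)`. -/
theorem Reaches.prod_eq {F : K⟦X⟧[X]} (hF : F.Monic) {R : Type u} [CommRing R] [Algebra K R]
    {t : Tower K R} {m : ℕ} {l : List (R⟦X⟧[X])} (h : Reaches F t m l) :
    (∀ P ∈ l, P.Monic) ∧
      ∃ hm : m ≠ 0, l.prod = ramify m hm (baseChange (algebraMap K R) F) := by
  induction h with
  | start =>
    refine ⟨by simpa using hF, one_ne_zero, ?_⟩
    rw [List.prod_singleton, ramify, baseChange, PowerSeries.expand_one, Polynomial.map_map]
    conv_lhs => rw [← Polynomial.map_id (p := F)]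
    congr 1
  | @step R _ _ t m pre H post h hpre hH R' _ _ t' ρ href q hqm hqs hqd e he G G' hkey ih =>
    obtain ⟨hmon, hm, hprod⟩ := ih
    obtain ⟨hG, hG', hGG'⟩ := hkey.mul_eq ((hmon H (by simp)).map _)
    set f := (AdjoinRoot.of q).comp (ρ : R →+* R') with hf
    refine ⟨?_, mul_ne_zero hm he, ?_⟩
    · simp only [List.mem_append, List.mem_map, List.mem_cons]
      rintro P (⟨Q, hQ, rfl⟩ | rfl | rfl | ⟨Q, hQ, rfl⟩)
      · exact ((hmon Q (by simp [hQ])).map _).map _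
      · exact hG
      · exact hG'
      · exact ((hmon Q (by simp [hQ])).map _).map _
    · have hlist : ∀ l : List (R⟦X⟧[X]), (l.map fun P => ramify e he (baseChange f P)).prod =
          ramify e he (baseChange f l.prod) := by
        intro l
        simp only [ramify, baseChange, Polynomial.map_map]
        exact (map_list_prod (Polynomial.mapRingHom _) l).symm
      rw [baseChange_baseChange, ← hf] at hGG'
      have hfK : f.comp (algebraMap K R) = algebraMap K (AdjoinRoot q) := by
        ext x
        simp [hf, AdjoinRoot.algebraMap_eq']
      have hmul : ∀ P Q : R⟦X⟧[X], ramify e he (baseChange f (P * Q)) =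
          ramify e he (baseChange f P) * ramify e he (baseChange f Q) := by
        intro P Q
        simp only [ramify, baseChange, Polynomial.map_mul]
      rw [← ramify_ramify e m he hm, ← hfK, ← baseChange_baseChange, ← baseChange_ramify, ← hprod,
        List.prod_append, List.prod_append, List.prod_cons, List.prod_cons, List.prod_cons, hlist,
        hlist, hmul, hmul, ← hGG', mul_assoc]

end Run

/-! ### Descent of the adjoined elements to `k` -/

section Roots

variable {K : Type u} [Field K] {k L : Type v} [Field k] [Algebra K k] [Field L] [Algebra K L]

/-- If the factor produced by a step divides a polynomial with all its roots in `k⟦X⟧`, then the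
element adjoined in this step lies in `k`. -/
theorem KeyStep.root_mem_range (f : k →ₐ[K] L) {R' : Type u} [CommRing R'] [Algebra K R']
    {q : R'[X]} {H : R'⟦X⟧[X]} {e : ℕ} {he : e ≠ 0} {G G' : (AdjoinRoot q)⟦X⟧[X]}
    (h : KeyStep K q H e he G G') (φ : AdjoinRoot q →ₐ[K] L)
    (hφ : ∀ x, φ (AdjoinRoot.of q x) ∈ f.range) {P : k⟦X⟧[X]} (hP : P.Splits) (hPm : P.Monic)
    {m₀ : ℕ} (hm₀ : m₀ ≠ 0)
    (hdvd : ramify m₀ hm₀ (baseChange (φ : AdjoinRoot q →+* L) G) ∣ baseChange (f : k →+* L) P) :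
    φ (AdjoinRoot.root q) ∈ f.range := by
  obtain ⟨n, -, _, -, -, -, -, -, -, -, d, -, -, -, s, hs, -, -, -, G₁, -, hG₁, -, -, hG₁0, -,
    c, hc, hG, -⟩ := h
  have := (φ : AdjoinRoot q →+* L).domain_nontrivial
  set Θ : (AdjoinRoot q)⟦X⟧ →+* L⟦X⟧ :=
    (PowerSeries.expand m₀ hm₀ : L⟦X⟧ →ₐ[L] L⟦X⟧).toRingHom.comp
      (PowerSeries.map (φ : AdjoinRoot q →+* L)) with hΘ
  have hΘX : Θ (PowerSeries.X ^ d) = PowerSeries.X ^ (m₀ * d) := by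
    rw [hΘ, map_pow, pow_mul]
    simp
  have hΘG : ramify m₀ hm₀ (baseChange (φ : AdjoinRoot q →+* L) G) =
      ((G₁.map Θ).scaleRoots (PowerSeries.X ^ (m₀ * d))).comp
        (Polynomial.X + Polynomial.C (Θ c)) := by
    rw [ramify, baseChange, Polynomial.map_map, ← hΘ, hG, Polynomial.map_comp,
      Polynomial.map_scaleRoots _ _ _ (by rw [hG₁.leadingCoeff, map_one]; exact one_ne_zero), hΘX]
    simp
  have hdeg : G₁.natDegree = s := by
    rw [← hG₁.natDegree_map (PowerSeries.constantCoeff (R := AdjoinRoot q)), ← atZero, hG₁0,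
      (Polynomial.monic_X_sub_C _).natDegree_pow, Polynomial.natDegree_X_sub_C, mul_one]
  -- `G` has the degree `s > 0` of `G₁`, so its image, a divisor of a split polynomial, has a root.
  obtain ⟨y, hy⟩ := ((hP.map (PowerSeries.map (f : k →+* L))).of_dvd (hPm.map _).ne_zero
    hdvd).exists_eval_eq_zero (by
      refine (Polynomial.natDegree_pos_iff_degree_pos.mp ?_).ne'
      rwa [hΘG, ← Polynomial.taylor_apply, Polynomial.natDegree_taylor,
        Polynomial.natDegree_scaleRoots, hG₁.natDegree_map, hdeg])
  -- `P` splits over `k⟦X⟧`, so passing to `L⟦X⟧` creates no new roots.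
  obtain ⟨ξ, rfl⟩ : y ∈ (PowerSeries.map (f : k →+* L)).range := by
    have h1 : y ∈ (P.map (PowerSeries.map (f : k →+* L))).roots := by
      rw [Polynomial.mem_roots (hPm.map _).ne_zero]
      exact Polynomial.IsRoot.dvd hy hdvd
    rw [hP.roots_map_of_injective (i := PowerSeries.map (f : k →+* L))
      (PowerSeries.map_injective _ (f : k →+* L).injective), Multiset.mem_map] at h1
    obtain ⟨ξ, -, hξ⟩ := h1
    exact ⟨ξ, hξ⟩
  rw [hΘG, Polynomial.eval_comp] at hy
  obtain ⟨z, hz, hz0⟩ := dvd_of_scaleRoots_eval_eq_zero (hG₁.map Θ)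
    (pow_ne_zero _ PowerSeries.X_ne_zero) hy
  -- At `T = 0` the equation for `z` becomes `(z(0) - φ(a))ˢ = 0`.
  have hz1 : PowerSeries.constantCoeff z = φ (AdjoinRoot.root q) := by
    have h1 := congrArg (PowerSeries.constantCoeff (R := L)) hz0
    have h2 : (PowerSeries.constantCoeff (R := L)).comp Θ =
        (φ : AdjoinRoot q →+* L).comp (PowerSeries.constantCoeff (R := AdjoinRoot q)) := by
      ext x
      simp [hΘ, ← PowerSeries.coeff_zero_eq_constantCoeff_apply (PowerSeries.map _ _)]
    rw [map_zero, ← Polynomial.eval₂_hom, ← Polynomial.eval_map, Polynomial.map_map, h2,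
      ← Polynomial.map_map, ← atZero, hG₁0] at h1
    simpa [sub_eq_zero, hs.ne'] using h1
  -- Compare coefficients of `T^(m₀ d)` in `y + c(T^m₀) = T^(m₀ d) z`: the right side gives `φ(a)`.
  -- On the left, `y` is a series over `k` and `c` has its coefficients in the image of `R'`.
  have hz2 := congrArg (PowerSeries.coeff (m₀ * d)) hz
  rw [PowerSeries.coeff_X_pow_mul', if_pos le_rfl, Nat.sub_self,
    PowerSeries.coeff_zero_eq_constantCoeff_apply, hz1] at hz2
  rw [← hz2]
  simp only [Polynomial.eval_add, Polynomial.eval_X, Polynomial.eval_C, map_add]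
  refine add_mem ⟨PowerSeries.coeff (m₀ * d) ξ, by simp⟩ ?_
  have hΘc : PowerSeries.coeff (m₀ * d) (Θ c) = φ (PowerSeries.coeff d c) := by
    simp [hΘ]
  rw [hΘc, hc, PowerSeries.coeff_map]
  exact hφ _

/-- Induction on the run: the image of `S = R'[a]` is generated by that of `R'`, a quotient of `R`,
and by that of `a`. -/
theorem Reaches.range_le [IsAlgClosed L] (f : k →ₐ[K] L) {F : K⟦X⟧[X]} (hF : F.Monic) {m₀ : ℕ}
    (hm₀ : m₀ ≠ 0) (hsplit : (ramify m₀ hm₀ (baseChange (algebraMap K k) F)).Splits)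
    {R : Type u} [CommRing R] [Algebra K R] {t : Tower K R} {m : ℕ} {l : List (R⟦X⟧[X])}
    (h : Reaches F t m l) (φ : R →ₐ[K] L) : φ.range ≤ f.range := by
  induction h with
  | start =>
    rintro _ ⟨x, rfl⟩
    exact ⟨algebraMap K k x, (f.commutes x).trans (φ.commutes x).symm⟩
  | @step R _ _ t m pre H post h hpre hH R' _ _ t' ρ href q hqm hqs hqd e he G G' hkey ih =>
    obtain ⟨-, hme, hprod⟩ := (Reaches.step h hpre hH href q hqm hqs hqd e he G G' hkey).prod_eq hF
    have hof : ∀ x, φ (AdjoinRoot.of q x) ∈ f.range := by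
      intro x
      obtain ⟨y, rfl⟩ := href.surjective x
      exact ih ((φ.comp (AdjoinRoot.ofAlgHom K q)).comp ρ) ⟨y, rfl⟩
    have hroot : φ (AdjoinRoot.root q) ∈ f.range := by
      -- The polynomial divisible by `G(T^m₀, Y)` is `F(T^(m e m₀), Y)`. Read as `F(T^m₀, Y)` with
      -- `T ↦ T^(m e)`, it inherits the splitting over `k⟦T⟧`.
      refine hkey.root_mem_range f φ hof
        (P := ramify (m * e) hme (ramify m₀ hm₀ (baseChange (algebraMap K k) F)))
        (hsplit.map _) (((hF.map _).map _).map _) hm₀ ?_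
      rw [baseChange_ramify, baseChange_ramify, baseChange_baseChange, ramify_ramify]
      have hcomp : (f : k →+* L).comp (algebraMap K k) =
          (φ : AdjoinRoot q →+* L).comp (algebraMap K (AdjoinRoot q)) := by
        ext x
        simp
      simp only [mul_comm m₀ (m * e)]
      rw [hcomp, ← baseChange_baseChange, ← ramify_ramify m₀ (m * e) hm₀ hme,
        ← baseChange_ramify _ (m * e), ← hprod]
      have hGl : G ∣ (pre.map (fun P => ramify e he (baseChange ((AdjoinRoot.of q).comp
          (ρ : R →+* R')) P)) ++ G :: G' :: post.map (fun P => ramify e he (baseChange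
            ((AdjoinRoot.of q).comp (ρ : R →+* R')) P))).prod :=
        List.dvd_prod (by simp)
      exact Polynomial.map_dvd _ (Polynomial.map_dvd _ hGl)
    rintro _ ⟨x, rfl⟩
    change φ x ∈ f.range
    induction x using AdjoinRoot.induction_on with
    | ih g =>
      induction g using Polynomial.induction_on' with
      | add g₁ g₂ h₁ h₂ =>
        rw [map_add, map_add]
        exact add_mem h₁ h₂
      | monomial n a =>
        rw [← Polynomial.C_mul_X_pow_eq_monomial, map_mul, map_pow, AdjoinRoot.mk_C,
          AdjoinRoot.mk_X, map_mul, map_pow]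
        exact mul_mem (hof a) (pow_mem hroot n)

end Roots

end DynamicPuiseux

open DynamicPuiseux

/-- An algebra obtained by the algorithm splits every other one. -/
theorem DynamicPuiseux.Produced.splits {K : Type u} [Field K] {F : K⟦X⟧[X]} (hF : F.Monic)
    {A : Type u} [CommRing A] [Algebra K A] {tA : Tower K A} (hA : Produced F tA)
    {B : Type u} [CommRing B] [Algebra K B] {tB : Tower K B} (hB : Produced F tB) :
    Splits A tB := by
  obtain ⟨m, l, hrA, hl⟩ := hA
  obtain ⟨m', l', hrB, -⟩ := hB
  obtain ⟨hmon, hm, hprod⟩ := hrA.prod_eq hF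
  obtain ⟨_, _⟩ := tA.finite_formallyUnramified
  have : IsReduced A := Algebra.FormallyUnramified.isReduced_of_field K A
  have : IsArtinianRing A := IsArtinianRing.of_finite K A
  refine splits_of_algEquiv_pi ((IsArtinianRing.equivPi A).restrictScalars K) tB fun I => ?_
  let _ : Field (A ⧸ I.asIdeal) := Ideal.Quotient.field I.asIdeal
  let π : A →+* A ⧸ I.asIdeal := Ideal.Quotient.mk I.asIdeal
  refine splits_of_forall_range_le
    (IsScalarTower.toAlgHom K (A ⧸ I.asIdeal) (AlgebraicClosure (A ⧸ I.asIdeal))) tB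
    fun φ => hrB.range_le _ hF hm ?_ φ
  -- Over the residue field, `F(Tᵐ, Y)` is the image of the product of the final linear factors of
  -- the run for `A`.
  have hπ : algebraMap K (A ⧸ I.asIdeal) = π.comp (algebraMap K A) := rfl
  rw [hπ, ← baseChange_baseChange, ← baseChange_ramify, ← hprod]
  refine Polynomial.Splits.map (Polynomial.Splits.listProd fun P hP => ?_) _
  exact Polynomial.Splits.of_natDegree_le_one_of_monic (hl P hP).le (hmon P hP)

theorem mainTheorem7 {K : Type u} [Field K] [CharZero K] (F : K⟦X⟧[X]) (hmonic : F.Monic)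
    (hdeg : 0 < F.natDegree)
    (hsep : (F.map (algebraMap K⟦X⟧ (LaurentSeries K))).Separable) :
    (∀ (A : Type u) [CommRing A] [Algebra K A] (tA : DynamicPuiseux.Tower K A)
        (B : Type u) [CommRing B] [Algebra K B] (tB : DynamicPuiseux.Tower K B),
        DynamicPuiseux.Produced F tA → DynamicPuiseux.Produced F tB →
          DynamicPuiseux.Splits A tB ∧ DynamicPuiseux.Splits B tA) ∧
      (∀ (A : Type u) [CommRing A] [Algebra K A] (tA : DynamicPuiseux.Tower K A),
        DynamicPuiseux.Produced F tA → DynamicPuiseux.Splits A tA) :=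
  ⟨fun _ _ _ _ _ _ _ _ hA hB => ⟨hA.splits hmonic hB, hB.splits hmonic hA⟩,
    fun _ _ _ _ hA => hA.splits hmonic hA⟩
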